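/- All actions on metric spaces are isometric, and metrics take only finite values. Let $H$ be a subgroup of a group $G$, and let $H$ act on a metric space $R$. An action of $G$ on a metric space $S$ is an \emph{extension} of the action of $H$ on $R$ if there is a map $f\colon R\to S$ which is a quasi-isometric embedding (there is a constant $C>0$ such that $\frac1C d_R(x,y)-C\le d_S(f(x),f(y))\le C\,d_R(x,y)+C$ for all $x,y\in R$) and coarsely $H$-equivariant ($\sup_{h\in H} d_S(f(hx),hf(x))<\infty$ for every $x\in R$). The \emph{extension problem is solvable} for $H\le G$ if every action of $H$ on a metric space has an extension to an action of $G$ on some metric space. The class of \emph{elementary amenable} groups is the smallest class of groups that contains all abelian groups and all finite groups and is closed under taking subgroups, quotients, group extensions and directed unions. \textbf{Theorem.} Let $G$ be a finitely generated elementary amenable group. Then the extension problem is solvable for every subgroup $H\le G$ if and only if there exists a finite-index free abelian subgroup $A\le G$ (possibly of rank $0$) such that the action of $G$ on $A$ by conjugation factors through the action of $\mathbb Z/2\mathbb Z$ on $A$ by inversion, that is, there is a homomorphism $\varepsilon\colon G\to\mathbb Z/2\mathbb Z$ such that, for all $g\in G$ and $a\in A$, $gag^{-1}=a$ if $\varepsilon(g)=0$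 and $gag^{-1}=a^{-1}$ if $\varepsilon(g)\neq 0$. -/

import Mathlib

universe u v w

namespace ExtProblem

/-- The class of elementary amenable groups: the smallest class of groups that contains all abelian
and all finite groups and is closed under subgroups, quotients (both up to isomorphism), group
extensions and directed unions. -/
inductive IsElementaryAmenable : ∀ (G : Type u) [Group G], Prop
  | of_comm (G : Type u) [Group G] (h : ∀ a b : G, a * b = b * a) : IsElementaryAmenable G
  | of_finite (G : Type u) [Group G] (h : Finite G) : IsElementaryAmenable G
  | of_injective (G H : Type u) [Group G] [Group H] (f : H →* G) (hf : Function.Injective f)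
      (hG : IsElementaryAmenable G) : IsElementaryAmenable H
  | of_surjective (G Q : Type u) [Group G] [Group Q] (f : G →* Q) (hf : Function.Surjective f)
      (hG : IsElementaryAmenable G) : IsElementaryAmenable Q
  | of_extension (G : Type u) [Group G] (N : Subgroup G) [N.Normal]
      (hN : IsElementaryAmenable N) (hQ : IsElementaryAmenable (G ⧸ N)) : IsElementaryAmenable G
  | of_directed_union (G : Type u) [Group G] (F : Set (Subgroup G))
      (hdir : DirectedOn (· ≤ ·) F) (hunion : ∀ g : G, ∃ K ∈ F, g ∈ K)
      (hF : ∀ K ∈ F, IsElementaryAmenable K) : IsElementaryAmenable G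

/-- `f` is a quasi-isometric embedding. -/
def IsQuasiIsometricEmbedding {R : Type v} {S : Type w} [MetricSpace R] [MetricSpace S]
    (f : R → S) : Prop :=
  ∃ C : ℝ, 0 < C ∧ ∀ x y : R,
    (1 / C) * dist x y - C ≤ dist (f x) (f y) ∧ dist (f x) (f y) ≤ C * dist x y + C

/-- `f` is coarsely equivariant with respect to two isometric actions `φ`, `ψ` of a group `H`:
for each point `x`, the distances `d (f (h x), h (f x))` are bounded uniformly in `h`. -/
def IsCoarselyEquivariant {H : Type u} [Group H] {R : Type v} {S : Type w}
    [MetricSpace R] [MetricSpace S] (φ : H →* (R ≃ᵢ R)) (ψ : H →* (S ≃ᵢ S)) (f : R → S) : Prop :=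
  ∀ x : R, ∃ K : ℝ, ∀ h : H, dist (f (φ h x)) (ψ h (f x)) ≤ K

/-- The isometric action `ψ` of `G` on `S` is an extension of the isometric action `φ` of the
subgroup `H` on `R`. -/
def IsExtension {G : Type u} [Group G] {H : Subgroup G} {R : Type v} {S : Type w}
    [MetricSpace R] [MetricSpace S] (φ : H →* (R ≃ᵢ R)) (ψ : G →* (S ≃ᵢ S)) : Prop :=
  ∃ f : R → S, IsQuasiIsometricEmbedding f ∧ IsCoarselyEquivariant φ (ψ.comp H.subtype) f

/-- The extension problem is solvable for `H ≤ G`: every isometric action of `H` on a metric space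
has an extension to an isometric action of `G` on a metric space (both spaces range over the same,
arbitrary, universe). -/
def ExtensionProblemSolvable {G : Type u} [Group G] (H : Subgroup G) : Prop :=
  ∀ (R : Type w) [MetricSpace R] (φ : H →* (R ≃ᵢ R)),
    ∃ (S : Type w) (_ : MetricSpace S) (ψ : G →* (S ≃ᵢ S)), IsExtension φ ψ

/-- A (multiplicatively written) group is free abelian, of any rank, including rank zero. -/
def IsFreeAbelian (A : Type u) [Group A] : Prop :=
  ∃ ι : Type u, Nonempty (A ≃* Multiplicative (FreeAbelianGroup ι))

/-- The conjugation action of `G` on `A` factors through the action of `ℤ/2ℤ` on `A` in which the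
nontrivial element acts by inversion. (In particular `A` is normal in `G`.) -/
def ConjFactorsThroughInversion {G : Type u} [Group G] (A : Subgroup G) : Prop :=
  ∃ ε : G →* Multiplicative (ZMod 2), ∀ g : G, ∀ a ∈ A,
    (ε g = 1 → g * a * g⁻¹ = a) ∧ (ε g ≠ 1 → g * a * g⁻¹ = a⁻¹)

end ExtProblem

namespace ExtProblem

/-! ### Gluing: from a seminorm on the group to an extension of the action -/

/-! Solvability is a question about seminorms. The displacement `h ↦ d(x₀, h x₀)` of an action of
`H` is a seminorm on `H`. A seminorm on `G` that stays within bounded distance of it on `H` allows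
translates of `R` to be glued into a `G`-space (`exists_isExtension_of_groupSeminorm`). In the other
direction, extending the left translation action of `H`, metrized by a seminorm, yields a seminorm
on `G` whose restriction agrees with the given one up to affine constants
(`exists_groupSeminorm_of_extensionProblemSolvable`).

If `A` exists, then up to finite index it splits as `(H ∩ A) × C`. The displacement seminorm, pulled
back along the projection to `H ∩ A`, is conjugation invariant because seminorms are symmetric under
inversion, so it extends to `G` (`exists_groupSeminorm_extending`). Finitely many coset
representatives cost only a bounded error on `H` (`exists_groupSeminorm_near`).

Conversely, solvability for all subgroups has two consequences. Every subgroup is finitely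
generated, since otherwise the union of a strict chain carries a seminorm outgrowing word length.
And an element normalizing a torsion-free abelian subgroup `A` acts on it by `1` or `-1`: the
seminorms `|φ|` with `φ : A → ℤ` force it to preserve every kernel. Then adjoining a normalizing
element `t` keeps a subgroup virtually abelian, because `t²` centralizes a suitable `A`.

It remains to induct over elementary amenability. The two consequences hold for the fixed group `G`,
while the closure operations change the group, so the induction concerns subgroups `T` of `E × G`
with `E` varying (`IsElementaryAmenable.isVirtuallyAbelian_map_snd`). The diagonal of `G × G` then
shows that `G` is virtually abelian. -/

/-- An isometric action on a pseudometric space, as a homomorphism to the isometry group. -/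
noncomputable def isometryHom (G : Type u) [Group G] (X : Type v) [PseudoMetricSpace X]
    [MulAction G X] [IsIsometricSMul G X] : G →* (X ≃ᵢ X) where
  toFun g := IsometryEquiv.constSMul g
  map_one' := by ext x; simp
  map_mul' g g' := by ext x; simp [mul_smul]

/-- An exactly equivariant isometric map to a pseudometric `G`-space of the right size gives an
extension. -/
theorem exists_isExtension_of_isometry {G : Type u} [Group G] {H : Subgroup G} {R : Type w}
    [MetricSpace R] (φ : H →* (R ≃ᵢ R)) (X : Type v) [Small.{w} X] [PseudoMetricSpace X]
    [MulAction G X] [IsIsometricSMul G X] (f : R → X) (hf : Isometry f)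
    (heq : ∀ (h : H) (x : R), dist (f (φ h x)) ((h : G) • f x) = 0) :
    ∃ (S : Type w) (_ : MetricSpace S) (ψ : G →* (S ≃ᵢ S)), IsExtension φ ψ := by
  have : IsIsometricSMul G (SeparationQuotient X) := by
    refine ⟨fun g => Isometry.of_dist_eq fun a b => ?_⟩
    obtain ⟨a, rfl⟩ := SeparationQuotient.surjective_mk a
    obtain ⟨b, rfl⟩ := SeparationQuotient.surjective_mk b
    rw [← SeparationQuotient.mk_smul, ← SeparationQuotient.mk_smul, SeparationQuotient.dist_mk,
      SeparationQuotient.dist_mk, dist_smul]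
  have : Small.{w} (SeparationQuotient X) :=
    small_of_surjective SeparationQuotient.surjective_mk
  let e := equivShrink.{w} (SeparationQuotient X)
  let _ : MetricSpace (Shrink.{w} (SeparationQuotient X)) :=
    MetricSpace.induced e.symm e.symm.injective inferInstance
  have hd : ∀ a b : Shrink.{w} (SeparationQuotient X), dist a b = dist (e.symm a) (e.symm b) :=
    fun _ _ => rfl
  have hs : ∀ (g : G) (a : Shrink.{w} (SeparationQuotient X)), e.symm (g • a) = g • e.symm a :=
    fun g a => by simp [e]
  have : IsIsometricSMul G (Shrink.{w} (SeparationQuotient X)) :=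
    ⟨fun g => Isometry.of_dist_eq fun a b => by rw [hd, hs, hs, dist_smul, hd]⟩
  refine ⟨_, inferInstance, isometryHom G (Shrink.{w} (SeparationQuotient X)),
    fun x => e (SeparationQuotient.mk (f x)), ⟨1, one_pos, fun x y => ?_⟩, fun x => ⟨0, fun h => ?_⟩⟩
  · rw [hd, e.symm_apply_apply, e.symm_apply_apply, SeparationQuotient.dist_mk, hf.dist_eq]
    constructor <;> linarith
  · change dist _ ((h : G) • e (SeparationQuotient.mk (f x))) ≤ 0
    rw [hd, hs, e.symm_apply_apply, e.symm_apply_apply, ← SeparationQuotient.mk_smul,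
      SeparationQuotient.dist_mk]
    exact (heq h x).le

/-- The pseudometric given by the infimum of a family of costs which is closed under
concatenation. -/
@[reducible] noncomputable def pseudoMetricOfCost {X : Type v} (Cost : X → X → ℝ → Prop)
    (nonneg : ∀ p q r, Cost p q r → 0 ≤ r) (refl : ∀ p, Cost p p 0)
    (symm : ∀ p q r, Cost p q r → Cost q p r) (exists_cost : ∀ p q, ∃ r, Cost p q r)
    (trans : ∀ p q s r r', Cost p q r → Cost q s r' → ∃ r'' ≤ r + r', Cost p s r'') :
    PseudoMetricSpace X where
  dist p q := sInf {r | Cost p q r}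
  dist_self p := le_antisymm (csInf_le ⟨0, fun r hr => nonneg _ _ r hr⟩ (refl p))
    (le_csInf (exists_cost p p) fun r hr => nonneg _ _ r hr)
  dist_comm p q := congrArg sInf (Set.ext fun r => ⟨symm p q r, symm q p r⟩)
  dist_triangle p q s := by
    refine le_of_forall_pos_lt_add fun ε hε => ?_
    obtain ⟨r, hr, hr'⟩ := exists_lt_of_csInf_lt (exists_cost p q)
      (lt_add_of_pos_right (sInf {r | Cost p q r}) (half_pos hε))
    obtain ⟨t, ht, ht'⟩ := exists_lt_of_csInf_lt (exists_cost q s)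
      (lt_add_of_pos_right (sInf {r | Cost q s r}) (half_pos hε))
    obtain ⟨c, hc, hc'⟩ := trans p q s r t hr ht
    have : sInf {r | Cost p s r} ≤ c := csInf_le ⟨0, fun r hr => nonneg _ _ r hr⟩ hc'
    linarith

section Glue

variable {G : Type u} [Group G] {H : Subgroup G} {R : Type w} [MetricSpace R]

/-- The costs on `G × R` whose infimum is the glued pseudometric: move inside one copy of `R`, or
move to the orbit of `x₀`, travel along `G`, and leave the orbit of `x₀`. -/
def GlueCost (φ : H →* (R ≃ᵢ R)) (x₀ : R) (L : GroupSeminorm G) (K : ℝ) (p q : G × R) (r : ℝ) :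
    Prop :=
  (∃ h : H, q.1 = p.1 * h ∧ r = dist p.2 (φ h q.2)) ∨
  ∃ h h' : H, r = dist p.2 (φ h x₀) + L ((p.1 * h)⁻¹ * (q.1 * h')) + K + dist (φ h' x₀) q.2

/-- The toll `K` on each jump through the orbit of `x₀` does two jobs: it keeps jumps from
shortening distances inside a copy of `R`, and it lets two consecutive jumps be replaced by one. -/
theorem exists_isExtension_of_groupSeminorm [Small.{w} G] (φ : H →* (R ≃ᵢ R)) (x₀ : R)
    (L : GroupSeminorm G) (K : ℝ) (hL : ∀ h : H, |L h - dist x₀ (φ h x₀)| ≤ K) :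
    ∃ (S : Type w) (_ : MetricSpace S) (ψ : G →* (S ≃ᵢ S)), IsExtension φ ψ := by
  have hK : 0 ≤ K := (abs_nonneg _).trans (hL 1)
  have hd : ∀ (h : H) (x y : R), dist (φ h x) (φ h y) = dist x y := fun h x y =>
    (φ h).isometry.dist_eq x y
  have hm : ∀ (h h' : H) (x : R), φ (h * h') x = φ h (φ h' x) := fun h h' x => by
    rw [map_mul]; rfl
  have hi : ∀ (h : H) (x y : R), dist (φ h⁻¹ x) y = dist x (φ h y) := fun h x y => by
    rw [← hd h, ← hm]; simp
  have hLd : ∀ h h' : H, |L ((h : G)⁻¹ * h') - dist (φ h x₀) (φ h' x₀)| ≤ K := fun h h' => by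
    have := hL (h⁻¹ * h')
    rw [hm, dist_comm, hi, dist_comm] at this
    simpa using this
  let Cost := GlueCost φ x₀ L K
  have nonneg : ∀ p q r, Cost p q r → 0 ≤ r := by
    rintro p q r (⟨h, -, rfl⟩ | ⟨h, h', rfl⟩)
    · positivity
    · have := apply_nonneg L ((p.1 * h)⁻¹ * (q.1 * h'))
      positivity
  have refl : ∀ p, Cost p p 0 := fun p => Or.inl ⟨1, by simp, by simp⟩
  have symm : ∀ p q r, Cost p q r → Cost q p r := by
    rintro p q r (⟨h, hq, rfl⟩ | ⟨h, h', rfl⟩)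
    · refine Or.inl ⟨h⁻¹, by simp [hq], ?_⟩
      rw [dist_comm q.2, hi]
    · refine Or.inr ⟨h', h, ?_⟩
      rw [← map_inv_eq_map L ((q.1 * h')⁻¹ * (p.1 * h)), mul_inv_rev ((q.1 * h')⁻¹), inv_inv,
        dist_comm q.2, dist_comm p.2]
      ring
  have exists_cost : ∀ p q, ∃ r, Cost p q r := fun p q => ⟨_, Or.inr ⟨1, 1, rfl⟩⟩
  have trans : ∀ p q s r r', Cost p q r → Cost q s r' → ∃ r'' ≤ r + r', Cost p s r'' := by
    rintro ⟨g, x⟩ ⟨g', x'⟩ ⟨g'', x''⟩ r r' (⟨h, hq, rfl⟩ | ⟨h, h', rfl⟩)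
      (⟨k, hs, rfl⟩ | ⟨k, k', rfl⟩) <;> dsimp only at *
    · refine ⟨_, ?_, Or.inl ⟨h * k, by simp [hs, hq, mul_assoc], rfl⟩⟩
      dsimp only
      rw [hm, ← hd h x']
      exact dist_triangle _ _ _
    · refine ⟨_, ?_, Or.inr ⟨h * k, k', rfl⟩⟩
      dsimp only
      rw [hm, ← hd h x', hq, Subgroup.coe_mul, mul_assoc g]
      linarith [dist_triangle x (φ h x') (φ h (φ k x₀))]
    · refine ⟨_, ?_, Or.inr ⟨h, k⁻¹ * h', rfl⟩⟩
      dsimp only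
      rw [hm, hi, hs, show g' * (k : G) * ((k⁻¹ * h' : H) : G) = g' * h' by simp [mul_assoc]]
      linarith [dist_triangle (φ h' x₀) x' (φ k x'')]
    -- Two jumps pay `2 * K` and the merged jump pays `K`. The spare `K` covers the replacement of
    -- the walk from `φ h' x₀` to `φ k x₀` by `L (h'⁻¹ * k)`.
    · refine ⟨_, ?_, Or.inr ⟨h, k', rfl⟩⟩
      dsimp only
      have h1 := dist_triangle (φ h' x₀) x' (φ k x₀)
      have h2 := (abs_le.1 (hLd h' k)).2
      have h3 := map_mul_le_add L ((g * h)⁻¹ * (g' * h')) ((h' : G)⁻¹ * k)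
      have h4 := map_mul_le_add L ((g * h)⁻¹ * (g' * h') * ((h' : G)⁻¹ * k))
        ((g' * k)⁻¹ * (g'' * k'))
      rw [show (g * h)⁻¹ * (g' * h') * ((h' : G)⁻¹ * k) * ((g' * k)⁻¹ * (g'' * k')) =
        (g * h)⁻¹ * (g'' * k') by group] at h4
      linarith
  let _ : PseudoMetricSpace (G × R) :=
    pseudoMetricOfCost Cost nonneg refl symm exists_cost trans
  have hdist : ∀ p q : G × R, dist p q = sInf {r | Cost p q r} := fun _ _ => rfl
  let _ : MulAction G (G × R) :=
    { smul := fun g p => (g * p.1, p.2)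
      one_smul := fun p => Prod.ext (one_mul _) rfl
      mul_smul := fun g g' p => Prod.ext (mul_assoc _ _ _) rfl }
  have hsmul : ∀ (g : G) (p : G × R), g • p = (g * p.1, p.2) := fun _ _ => rfl
  have hinv : ∀ (g : G) (p q : G × R) (r : ℝ), Cost (g • p) (g • q) r ↔ Cost p q r := by
    intro g p q r
    simp only [Cost, GlueCost, hsmul, mul_assoc, mul_right_inj, mul_inv_rev, inv_mul_cancel_left]
  have : IsIsometricSMul G (G × R) := ⟨fun g => Isometry.of_dist_eq fun p q => by
    rw [hdist, hdist]; simp only [hinv]⟩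
  refine exists_isExtension_of_isometry φ (G × R) (fun x => (1, x))
    (Isometry.of_dist_eq fun x y => ?_) fun h x => ?_
  · rw [hdist]
    refine le_antisymm (csInf_le ⟨0, fun r hr => nonneg _ _ r hr⟩ (Or.inl ⟨1, by simp, by simp⟩))
      (le_csInf (exists_cost _ _) ?_)
    rintro r (⟨h, hq, rfl⟩ | ⟨h, h', rfl⟩)
    · have : h = 1 := by ext; simpa using hq.symm
      simp [this]
    -- A jump from the copy of `R` to itself is no shortcut: `L + K` is at least the distance
    -- between the two orbit points.
    · have h1 := (abs_le.1 (hLd h h')).1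
      have h2 := dist_triangle4 x (φ h x₀) (φ h' x₀) y
      simp only [one_mul]
      linarith
  · rw [hdist]
    refine le_antisymm (csInf_le ⟨0, fun r hr => nonneg _ _ r hr⟩
      (Or.inl ⟨h, by simp [hsmul], by simp [hsmul]⟩))
      (le_csInf (exists_cost _ _) fun r hr => nonneg _ _ r hr)

end Glue

/-! ### Subgroups of finite relative index -/

section RelIndex

variable {G : Type u} [Group G] {H K : Subgroup G}

theorem relIndex_ne_zero_of_finite_cover {s : Set G} (hs : s.Finite)
    (h : ∀ x ∈ K, ∃ y ∈ s, y⁻¹ * x ∈ H) : H.relIndex K ≠ 0 := by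
  have := hs.to_subtype
  choose! y hy hy' using h
  have : Finite (K ⧸ H.subgroupOf K) := by
    refine Finite.of_injective (fun q => (⟨y (q.out : K), hy _ (q.out : K).2⟩ : s)) ?_
    intro q q' hqq
    have hqq : y (q.out : K) = y (q'.out : K) := congrArg Subtype.val hqq
    rw [← q.out_eq', ← q'.out_eq']
    refine QuotientGroup.eq.2 (Subgroup.mem_subgroupOf.2 ?_)
    have := H.mul_mem (H.inv_mem (hy' _ (q.out : K).2)) (hy' _ (q'.out : K).2)
    rw [hqq] at this
    simpa using this
  exact Subgroup.index_ne_zero_of_finite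

theorem exists_finite_cover_of_relIndex_ne_zero (h : H.relIndex K ≠ 0) :
    ∃ s : Set G, s.Finite ∧ s ⊆ K ∧ ∀ x ∈ K, ∃ y ∈ s, y⁻¹ * x ∈ H := by
  have : (H.subgroupOf K).FiniteIndex := ⟨h⟩
  refine ⟨Set.range fun q : K ⧸ H.subgroupOf K => (q.out : G), Set.finite_range _, ?_, ?_⟩
  · rintro _ ⟨q, rfl⟩
    exact (q.out : K).2
  · intro x hx
    refine ⟨_, ⟨((⟨x, hx⟩ : K) : K ⧸ H.subgroupOf K), rfl⟩, ?_⟩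
    have := QuotientGroup.eq.1 (((⟨x, hx⟩ : K) : K ⧸ H.subgroupOf K).out_eq')
    exact Subgroup.mem_subgroupOf.1 this

/-- A subgroup of a finitely generated abelian group which contains a power of each element has
finite index. -/
theorem relIndex_ne_zero_of_pow_mem (hK : K.FG) (hcomm : ∀ a ∈ K, ∀ b ∈ K, a * b = b * a)
    (hpow : ∀ a ∈ K, ∃ n : ℕ, 0 < n ∧ a ^ n ∈ H) : H.relIndex K ≠ 0 := by
  let _ : CommGroup K := { mul_comm := fun a b => Subtype.ext (hcomm a a.2 b b.2) }
  have : Group.FG K := (Group.fg_iff_subgroup_fg K).2 hK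
  have : Group.FG (K ⧸ H.subgroupOf K) := QuotientGroup.fg _
  have : Finite (K ⧸ H.subgroupOf K) := by
    refine CommGroup.finite_of_fg_isMulTorsion _ ?_
    intro q
    obtain ⟨a, rfl⟩ := QuotientGroup.mk_surjective q
    obtain ⟨n, hn, ha⟩ := hpow a a.2
    refine isOfFinOrder_iff_pow_eq_one.2 ⟨n, hn, ?_⟩
    rw [← QuotientGroup.mk_pow, QuotientGroup.eq_one_iff, Subgroup.mem_subgroupOf]
    simpa using ha
  exact Subgroup.index_ne_zero_of_finite

theorem mem_normalizer_of_conj_mem {t : G} (h : ∀ x ∈ H, t * x * t⁻¹ ∈ H)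
    (h' : ∀ x ∈ H, t⁻¹ * x * t ∈ H) : t ∈ Subgroup.normalizer (H : Set G) :=
  Subgroup.mem_normalizer_iff.2 fun x => ⟨h x, fun hx => by simpa [mul_assoc] using h' _ hx⟩

theorem exists_mul_zpow_of_mem_sup_zpowers {t x : G}
    (ht : t ∈ Subgroup.normalizer (H : Set G)) (hx : x ∈ H ⊔ Subgroup.zpowers t) :
    ∃ c ∈ H, ∃ n : ℤ, c * t ^ n = x := by
  have hconj : ∀ (n : ℤ), ∀ d ∈ H, t ^ n * d * (t ^ n)⁻¹ ∈ H := fun n d hd =>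
    (Subgroup.mem_normalizer_iff.1 (Subgroup.zpow_mem _ ht n) d).1 hd
  rw [Subgroup.sup_eq_closure] at hx
  refine Subgroup.closure_induction
    (p := fun x _ => ∃ c ∈ H, ∃ n : ℤ, c * t ^ n = x) ?_ ?_ ?_ ?_ hx
  · rintro y (hy | ⟨n, rfl⟩)
    · exact ⟨y, hy, 0, by simp⟩
    · exact ⟨1, H.one_mem, n, by simp⟩
  · exact ⟨1, H.one_mem, 0, by simp⟩
  · rintro _ _ _ _ ⟨c, hc, n, rfl⟩ ⟨d, hd, m, rfl⟩
    exact ⟨c * (t ^ n * d * (t ^ n)⁻¹), H.mul_mem hc (hconj n d hd), n + m, by group⟩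
  · rintro _ _ ⟨c, hc, n, rfl⟩
    exact ⟨_, hconj (-n) _ (H.inv_mem hc), -n, by group⟩

/-- In a finitely generated abelian subgroup, each subgroup has a complement up to finite index. -/
theorem exists_disjoint_relIndex_ne_zero {A B : Subgroup G} (hA : A.FG)
    (hcomm : ∀ a ∈ A, ∀ b ∈ A, a * b = b * a) :
    ∃ C ≤ A, Disjoint B C ∧ (B ⊔ C).relIndex A ≠ 0 := by
  obtain ⟨C, -, hC⟩ := zorn_le_nonempty₀ {C : Subgroup G | C ≤ A ∧ Disjoint B C} (by
    intro c hc hchain D hD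
    refine ⟨sSup c, ⟨sSup_le fun E hE => (hc hE).1, ?_⟩, fun z hz => le_sSup hz⟩
    rw [Subgroup.disjoint_def]
    intro x hxB hx
    obtain ⟨E, hE, hxE⟩ := (Subgroup.mem_sSup_of_directedOn ⟨D, hD⟩ hchain.directedOn).1 hx
    exact Subgroup.disjoint_def.1 (hc hE).2 hxB hxE) ⊥ ⟨bot_le, disjoint_bot_right⟩
  -- By maximality of `C`, adjoining any `a ∉ C` creates a nontrivial intersection with `B`, that
  -- is, an element `c * a ^ n` of `B` with `n ≠ 0`. So a power of `a` lies in `B ⊔ C`.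
  refine ⟨C, hC.prop.1, hC.prop.2, relIndex_ne_zero_of_pow_mem hA hcomm fun a ha => ?_⟩
  by_cases haC : a ∈ C
  · exact ⟨1, one_pos, by simpa using Subgroup.mem_sup_right haC⟩
  have hnd : ¬ Disjoint B (C ⊔ Subgroup.zpowers a) := fun hd => haC <|
    hC.le_of_ge ⟨sup_le hC.prop.1 (by simpa using ha), hd⟩ le_sup_left
      (Subgroup.mem_sup_right (Subgroup.mem_zpowers a))
  rw [Subgroup.disjoint_def] at hnd
  push Not at hnd
  obtain ⟨x, hxB, hx, hx1⟩ := hnd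
  have hnorm : a ∈ Subgroup.normalizer (C : Set G) := by
    refine mem_normalizer_of_conj_mem (fun c hc => ?_) fun c hc => ?_
    · rwa [hcomm a ha c (hC.prop.1 hc), mul_inv_cancel_right]
    · rwa [hcomm _ (A.inv_mem ha) c (hC.prop.1 hc), inv_mul_cancel_right]
  obtain ⟨c, hc, n, rfl⟩ := exists_mul_zpow_of_mem_sup_zpowers hnorm hx
  have hn : n ≠ 0 := by
    rintro rfl
    exact hx1 (Subgroup.disjoint_def.1 hC.prop.2 hxB (by simpa using hc))
  have hmem : a ^ n ∈ B ⊔ C := by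
    have := (B ⊔ C).mul_mem (Subgroup.mem_sup_right (C.inv_mem hc)) (Subgroup.mem_sup_left hxB)
    simpa using this
  refine ⟨n.natAbs, Int.natAbs_pos.2 hn, ?_⟩
  rcases Int.natAbs_eq n with h | h
  · rw [h, zpow_natCast] at hmem
    exact hmem
  · rw [h, zpow_neg, zpow_natCast] at hmem
    exact inv_mem_iff.1 hmem

end RelIndex

/-! ### Extending seminorms -/

section Extend

variable {G : Type u} [Group G]

/-- A conjugation invariant seminorm on a normal subgroup of finite index extends to the group. -/
theorem exists_groupSeminorm_extending (N : Subgroup G) [N.Normal] [N.FiniteIndex]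
    (ℓ : GroupSeminorm N)
    (hℓ : ∀ (g : G) (n n' : N), (n' : G) = g * n * g⁻¹ → ℓ n' = ℓ n) :
    ∃ L : GroupSeminorm G, ∀ n : N, L n = ℓ n := by
  have hc : ∀ x : G, ((x : G ⧸ N).out)⁻¹ * x ∈ N := fun x =>
    QuotientGroup.eq.1 (x : G ⧸ N).out_eq'
  let c : G → N := fun x => ⟨((x : G ⧸ N).out)⁻¹ * x, hc x⟩
  have hcN : ∀ (x : G) (n : N), c (x * n) = c x * n := fun x n => by
    ext
    simp only [c, Subgroup.coe_mul]
    rw [QuotientGroup.mk_mul_of_mem x n.2, mul_assoc]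
  -- `c (g * x) * (c x)⁻¹` is a cocycle in `g`, which makes its supremum over `x` subadditive. It
  -- depends only on the coset of `x`, so the supremum is over finitely many values.
  let F : G → G → ℝ := fun g x => ℓ (c (g * x) * (c x)⁻¹)
  have hbdd : ∀ g, BddAbove (Set.range (F g)) := fun g => by
    refine (Set.Finite.subset (Set.finite_range fun q : G ⧸ N => F g q.out) ?_).bddAbove
    rintro _ ⟨x, rfl⟩
    refine ⟨x, ?_⟩
    obtain ⟨n, hn⟩ := QuotientGroup.mk_out_eq_mul N x
    simp only [F]
    rw [hn, ← mul_assoc, hcN, hcN]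
    congr 1
    group
  have hF : ∀ g x, F g x ≤ ⨆ x, F g x := fun g x => le_ciSup (hbdd g) x
  refine ⟨{ toFun := fun g => ⨆ x, F g x, map_one' := ?_, mul_le' := ?_, inv' := ?_ }, ?_⟩
  · simp [F]
  · intro g g'
    refine ciSup_le fun x => ?_
    have : F (g * g') x ≤ F g (g' * x) + F g' x := by
      have := map_mul_le_add ℓ (c (g * (g' * x)) * (c (g' * x))⁻¹) (c (g' * x) * (c x)⁻¹)
      simpa [F, mul_assoc] using this
    linarith [hF g (g' * x), hF g' x]
  · have key : ∀ g, ⨆ x, F g⁻¹ x ≤ ⨆ x, F g x := fun g => ciSup_le fun x => by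
      refine le_trans (le_of_eq ?_) (hF g (g⁻¹ * x))
      simp only [F, mul_inv_cancel_left]
      rw [← map_inv_eq_map ℓ, mul_inv_rev, inv_inv]
    intro g
    exact le_antisymm (key g) (by simpa using key g⁻¹)
  · intro n
    -- For `n` in `N` the cocycle is the conjugate of `n` by the inverse of the coset representative
    -- of `x`.
    have : ∀ x, F n x = ℓ n := fun x => by
      refine hℓ ((x : G ⧸ N).out)⁻¹ n _ ?_
      have hx : x⁻¹ * n * x ∈ N := by simpa using ‹N.Normal›.conj_mem n n.2 x⁻¹
      have : c (n * x) = c x * ⟨x⁻¹ * n * x, hx⟩ := by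
        rw [← hcN]
        congr 1
        group
      rw [this]
      simp only [c, Subgroup.coe_mul, Subgroup.coe_inv]
      group
    change ⨆ x, F n x = ℓ n
    simp [this]

/-- If a finitely generated abelian subgroup `A` of finite index is centralized or inverted by each
element of `G`, then each seminorm on a subgroup extends to `G` up to a bounded error. -/
theorem exists_groupSeminorm_near [Group.FG G] {A : Subgroup G} [A.FiniteIndex]
    (hcomm : ∀ a ∈ A, ∀ b ∈ A, a * b = b * a)
    (hconj : ∀ g : G, (∀ a ∈ A, g * a * g⁻¹ = a) ∨ ∀ a ∈ A, g * a * g⁻¹ = a⁻¹)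
    (H : Subgroup G) (ℓ : GroupSeminorm H) :
    ∃ (L : GroupSeminorm G) (K : ℝ), ∀ h : H, |L h - ℓ h| ≤ K := by
  have hAfg : A.FG := (Group.fg_iff_subgroup_fg A).1 inferInstance
  have hnormal : ∀ D ≤ A, D.Normal := fun D hD => ⟨fun d hd g => by
    rcases hconj g with h | h
    · rwa [h d (hD hd)]
    · rw [h d (hD hd)]
      exact D.inv_mem hd⟩
  obtain ⟨C, hCA, hdisj, hind⟩ := exists_disjoint_relIndex_ne_zero (B := H ⊓ A) hAfg hcomm
  have hNA : (H ⊓ A) ⊔ C ≤ A := sup_le inf_le_right hCA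
  have := hnormal _ hNA
  have := hnormal C hCA
  have : ((H ⊓ A) ⊔ C).FiniteIndex := by
    refine ⟨?_⟩
    rw [← Subgroup.relIndex_mul_index hNA]
    exact mul_ne_zero hind Subgroup.FiniteIndex.index_ne_zero
  have hform : ∀ n : ((H ⊓ A) ⊔ C : Subgroup G), ∃ b : H, (b : G) ∈ A ∧ (b : G)⁻¹ * n ∈ C := by
    rintro ⟨n, hn⟩
    obtain ⟨y, hy, z, hz, rfl⟩ := Subgroup.mem_sup_of_normal_right.1 hn
    exact ⟨⟨y, hy.1⟩, hy.2, by simpa using hz⟩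
  choose β hβA hβ using hform
  have huniq : ∀ (n : ((H ⊓ A) ⊔ C : Subgroup G)) (b : H), (b : G) ∈ A → (b : G)⁻¹ * n ∈ C →
      β n = b := by
    intro n b hbA hb
    have h1 : (b : G)⁻¹ * β n ∈ C := by
      have := C.mul_mem hb (C.inv_mem (hβ n))
      simpa [mul_assoc] using this
    have h2 := Subgroup.disjoint_def.1 hdisj
      (show (b : G)⁻¹ * β n ∈ H ⊓ A from
        ⟨H.mul_mem (H.inv_mem b.2) (β n).2, A.mul_mem (A.inv_mem hbA) (hβA n)⟩) h1
    exact Subtype.ext (inv_mul_eq_one.1 h2).symm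
  have hβone : β 1 = 1 := huniq 1 1 A.one_mem (by simp)
  have hβmul : ∀ n m, β (n * m) = β n * β m := by
    intro n m
    refine huniq _ _ (A.mul_mem (hβA n) (hβA m)) ?_
    have h1 := ‹C.Normal›.conj_mem _ (hβ n) (β m : G)⁻¹
    have h2 := C.mul_mem h1 (hβ m)
    convert h2 using 1
    simp [mul_assoc]
  have hβinv : ∀ n, β n⁻¹ = (β n)⁻¹ := fun n =>
    eq_inv_of_mul_eq_one_left (by rw [← hβmul, inv_mul_cancel, hβone])
  -- The pullback of `ℓ` along the projection `β` with kernel `C`.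
  let ℓN : GroupSeminorm ((H ⊓ A) ⊔ C : Subgroup G) :=
    { toFun := fun n => ℓ (β n)
      map_one' := by rw [hβone, map_one_eq_zero]
      mul_le' := fun n m => by rw [hβmul]; exact map_mul_le_add ℓ _ _
      inv' := fun n => by rw [hβinv, map_inv_eq_map] }
  obtain ⟨L, hL⟩ := exists_groupSeminorm_extending _ ℓN (by
    intro g n n' hn
    rcases hconj g with h | h
    · rw [h n (hNA n.2)] at hn
      rw [Subtype.ext hn]
    · rw [h n (hNA n.2)] at hn
      rw [show n' = n⁻¹ from Subtype.ext hn, map_inv_eq_map])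
  have hLB : ∀ b : H, (b : G) ∈ A → L b = ℓ b := by
    intro b hb
    have := hL ⟨b, Subgroup.mem_sup_left ⟨b.2, hb⟩⟩
    have hb' : β ⟨b, Subgroup.mem_sup_left ⟨b.2, hb⟩⟩ = b := huniq _ b hb (by simp)
    change L b = ℓ (β ⟨b, Subgroup.mem_sup_left ⟨b.2, hb⟩⟩) at this
    rwa [hb'] at this
  have hAH : A.relIndex H ≠ 0 :=
    (inferInstance : (A.subgroupOf H).FiniteIndex).index_ne_zero
  obtain ⟨s, hs, hsH, hcover⟩ := exists_finite_cover_of_relIndex_ne_zero hAH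
  have hfin : (((↑) : H → G) ⁻¹' s).Finite := hs.preimage Subtype.val_injective.injOn
  obtain ⟨K, hK⟩ := (hfin.image fun t : H => L t + ℓ t).bddAbove
  refine ⟨L, K, fun h => ?_⟩
  obtain ⟨t, hts, ht⟩ := hcover h h.2
  lift t to H using hsH hts
  have hK' : L t + ℓ t ≤ K := hK ⟨t, hts, rfl⟩
  have e0 : L ((t : G)⁻¹ * h) = ℓ (t⁻¹ * h) := hLB (t⁻¹ * h) ht
  have e1 := map_mul_le_add L (t : G) ((t : G)⁻¹ * h)
  have e2 := map_mul_le_add ℓ t (t⁻¹ * h)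
  have e3 := map_mul_le_add L (t : G)⁻¹ h
  have e4 := map_mul_le_add ℓ t⁻¹ h
  rw [mul_inv_cancel_left] at e1 e2
  rw [map_inv_eq_map] at e3 e4
  rw [abs_le]
  constructor <;> linarith

end Extend

theorem exists_isExtension_of_isEmpty {G : Type u} [Group G] {H : Subgroup G} {R : Type w}
    [MetricSpace R] [IsEmpty R] (φ : H →* (R ≃ᵢ R)) :
    ∃ (S : Type w) (_ : MetricSpace S) (ψ : G →* (S ≃ᵢ S)), IsExtension φ ψ :=
  ⟨R, inferInstance, 1, id, ⟨1, one_pos, fun x => isEmptyElim x⟩, fun x => isEmptyElim x⟩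

theorem countable_of_fg (G : Type u) [Group G] [Group.FG G] : Countable G := by
  obtain ⟨α, _, f, hf⟩ := Group.fg_iff_exists_freeGroup_hom_surjective_finite.1 ‹Group.FG G›
  exact hf.countable

/-- The displacement seminorm of an isometric action at a point. -/
noncomputable def displacement {H : Type u} [Group H] {R : Type w} [MetricSpace R]
    (φ : H →* (R ≃ᵢ R)) (x₀ : R) : GroupSeminorm H where
  toFun h := dist x₀ (φ h x₀)
  map_one' := by simp
  mul_le' g h := by
    refine (dist_triangle x₀ (φ g x₀) _).trans_eq ?_
    rw [map_mul, IsometryEquiv.mul_apply, (φ g).isometry.dist_eq]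
  inv' h := by
    rw [← (φ h).isometry.dist_eq, ← IsometryEquiv.mul_apply, ← map_mul, mul_inv_cancel, map_one,
      dist_comm]
    rfl

theorem extensionProblemSolvable_of_conjFactorsThroughInversion {G : Type u} [Group G] [Group.FG G]
    {A : Subgroup G} [A.FiniteIndex] (hfree : IsFreeAbelian A)
    (hconj : ConjFactorsThroughInversion A) (H : Subgroup G) :
    ExtensionProblemSolvable.{u, w} H := by
  intro R _ φ
  rcases isEmpty_or_nonempty R with hR | ⟨⟨x₀⟩⟩
  · exact exists_isExtension_of_isEmpty φ
  obtain ⟨ι, ⟨e⟩⟩ := hfree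
  have hcomm : ∀ a ∈ A, ∀ b ∈ A, a * b = b * a := fun a ha b hb => by
    have : (⟨a, ha⟩ * ⟨b, hb⟩ : A) = ⟨b, hb⟩ * ⟨a, ha⟩ := e.injective (by
      rw [map_mul, map_mul, mul_comm])
    exact congrArg Subtype.val this
  obtain ⟨ε, hε⟩ := hconj
  obtain ⟨L, K, hL⟩ := exists_groupSeminorm_near hcomm (fun g => by
    by_cases hg : ε g = 1
    · exact Or.inl fun a ha => (hε g a ha).1 hg
    · exact Or.inr fun a ha => (hε g a ha).2 hg) H (displacement φ x₀)
  have := countable_of_fg G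
  exact exists_isExtension_of_groupSeminorm φ x₀ L K hL

/-! ### Consequences of solvability of the extension problem -/

section Solvable

variable {G : Type u} [Group G]

open Classical in
/-- The left invariant metric on a group associated with a seminorm, made positive off the
diagonal. -/
@[reducible] noncomputable def metricOfGroupSeminorm (ℓ : GroupSeminorm G) : MetricSpace G :=
  { dist := fun a b => if a = b then 0 else ℓ (a⁻¹ * b) + 1
    dist_self := fun a => if_pos rfl
    dist_comm := fun a b => by
      have : ℓ (a⁻¹ * b) = ℓ (b⁻¹ * a) := by rw [← map_inv_eq_map ℓ, mul_inv_rev, inv_inv]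
      simp only [this, eq_comm]
    dist_triangle := fun a b c => by
      have h := map_mul_le_add ℓ (a⁻¹ * b) (b⁻¹ * c)
      rw [mul_assoc, mul_inv_cancel_left] at h
      have h1 := apply_nonneg ℓ (a⁻¹ * b)
      have h2 := apply_nonneg ℓ (b⁻¹ * c)
      by_cases hab : a = b
      · subst hab; simp
      by_cases hbc : b = c
      · subst hbc; simp
      simp only [if_neg hab, if_neg hbc]
      split_ifs <;> linarith
    eq_of_dist_eq_zero := fun {a b} h => by
      by_contra hab
      have h1 := apply_nonneg ℓ (a⁻¹ * b)
      replace h := (if_neg hab).symm.trans h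
      linarith }

/-- The seminorm on `G` is the displacement, in the extended action, of the image of the identity of
`H`. Countability lets `H` be shrunk into the universe of the test spaces. -/
theorem exists_groupSeminorm_of_extensionProblemSolvable [Countable G] {H : Subgroup G}
    (hH : ExtensionProblemSolvable.{u, w} H) (ℓ : GroupSeminorm H) :
    ∃ (L : GroupSeminorm G) (C : ℝ), 0 < C ∧ ∀ h : H, ℓ h ≤ C * L h + C ∧ L h ≤ C * ℓ h + C := by
  let _ : MetricSpace H := metricOfGroupSeminorm ℓ
  have hdist : ∀ h h' : H, h ≠ h' → dist h h' = ℓ (h⁻¹ * h') + 1 := fun h h' hne => if_neg hne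
  have hdist_one : ∀ h : H, ℓ h ≤ dist 1 h ∧ dist 1 h ≤ ℓ h + 1 := fun h => by
    by_cases h1 : 1 = h
    · simp [← h1]
    · simp [hdist 1 h h1]
  have : IsIsometricSMul H H := ⟨fun g => Isometry.of_dist_eq fun a b => by
    by_cases hab : a = b
    · simp [hab]
    · rw [hdist a b hab, hdist _ _ (by simpa using hab)]
      simp [mul_assoc]⟩
  let e := equivShrink.{w} H
  let _ : MetricSpace (Shrink.{w} H) := MetricSpace.induced e.symm e.symm.injective inferInstance
  have hd : ∀ a b : Shrink.{w} H, dist a b = dist (e.symm a) (e.symm b) := fun _ _ => rfl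
  have hs : ∀ (g : H) (a : Shrink.{w} H), e.symm (g • a) = g • e.symm a :=
    fun g a => by simp [e]
  have : IsIsometricSMul H (Shrink.{w} H) :=
    ⟨fun g => Isometry.of_dist_eq fun a b => by rw [hd, hs, hs, dist_smul, hd]⟩
  obtain ⟨S, _, ψ, f, ⟨C, hC, hf⟩, heq⟩ := hH (Shrink.{w} H) (isometryHom H (Shrink.{w} H))
  obtain ⟨K, hK⟩ := heq (e 1)
  have hK0 : 0 ≤ K := dist_nonneg.trans (hK 1)
  -- The constant dominates the errors of both estimates, `ℓ ≤ C * (L + K + C)` and `L ≤ C * (ℓ + 1)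
  -- + C + K`.
  refine ⟨displacement ψ (f (e 1)), C + C * (K + C) + C + K, by positivity, fun h => ?_⟩
  have hLdef : displacement ψ (f (e 1)) h = dist (f (e 1)) (ψ h (f (e 1))) := rfl
  have hL0 := apply_nonneg (displacement ψ (f (e 1))) (h : G)
  have hℓ0 := apply_nonneg ℓ h
  obtain ⟨h1, h2⟩ := hf (e 1) (isometryHom H (Shrink.{w} H) h (e 1))
  have h3 : dist (e 1) (isometryHom H (Shrink.{w} H) h (e 1)) = dist 1 h := by
    change dist (e 1) (h • e 1) = _
    rw [hd, hs, e.symm_apply_apply, smul_eq_mul, mul_one]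
  rw [h3] at h1 h2
  have h4 : dist (f (isometryHom H (Shrink.{w} H) h (e 1))) (ψ h (f (e 1))) ≤ K := hK h
  obtain ⟨h5, h6⟩ := hdist_one h
  have h7 := dist_triangle (f (e 1)) (f (isometryHom H (Shrink.{w} H) h (e 1))) (ψ h (f (e 1)))
  have h8 := dist_triangle_right (f (e 1)) (f (isometryHom H (Shrink.{w} H) h (e 1)))
    (ψ h (f (e 1)))
  rw [← hLdef] at h7 h8
  set l := displacement ψ (f (e 1)) (h : G)
  have hCC : 0 ≤ C * (K + C) := by positivity
  constructor
  · have : dist 1 h ≤ C * (l + K + C) := by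
      rw [← div_le_iff₀' hC]
      have : dist 1 h / C = 1 / C * dist 1 h := by ring
      linarith
    nlinarith [mul_nonneg hCC hL0, mul_nonneg hC.le hL0, mul_nonneg hK0 hL0]
  · have : C * dist 1 h ≤ C * (ℓ h + 1) := by gcongr
    nlinarith [mul_nonneg hCC hℓ0, mul_nonneg hC.le hℓ0, mul_nonneg hK0 hℓ0]

/-- A word length dominates each seminorm on a finitely generated group. -/
theorem exists_wordLength (G : Type u) [Group G] [Group.FG G] :
    ∃ len : G → ℕ, ∀ L : GroupSeminorm G, ∃ C : ℝ, ∀ g, L g ≤ C * len g := by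
  obtain ⟨S, hS, hfin⟩ := Group.fg_iff.1 ‹Group.FG G›
  have : ∀ g : G, ∃ n : ℕ, ∀ (L : GroupSeminorm G) (C : ℝ), (∀ s ∈ S, L s ≤ C) → L g ≤ C * n := by
    intro g
    have hg : g ∈ Subgroup.closure S := hS ▸ Subgroup.mem_top g
    induction hg using Subgroup.closure_induction with
    | mem x hx => exact ⟨1, fun L C h => by simpa using h x hx⟩
    | one => exact ⟨0, fun L C h => by simp⟩
    | mul x y _ _ hx hy =>
      obtain ⟨n, hn⟩ := hx
      obtain ⟨m, hm⟩ := hy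
      refine ⟨n + m, fun L C h => (map_mul_le_add L x y).trans ?_⟩
      push_cast
      linarith [hn L C h, hm L C h]
    | inv x _ hx =>
      obtain ⟨n, hn⟩ := hx
      exact ⟨n, fun L C h => by rw [map_inv_eq_map]; exact hn L C h⟩
  choose len hlen using this
  refine ⟨len, fun L => ?_⟩
  obtain ⟨C, hC⟩ := (hfin.image L).bddAbove
  exact ⟨C, fun g => hlen g L C fun s hs => hC ⟨s, hs, rfl⟩⟩

/-- The seminorm on a union of a chain of subgroups given by a weight of the first subgroup of the
chain which contains the element. -/
theorem exists_groupSeminorm_of_chain {D : ℕ → Subgroup G} (hmono : Monotone D)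
    (hunion : ∀ g, ∃ n, g ∈ D n) {w : ℕ → ℝ} (hw : Monotone w) (hw0 : w 0 = 0) :
    ∃ ℓ : GroupSeminorm G, ∀ n, ∀ g ∈ D (n + 1), g ∉ D n → ℓ g = w (n + 1) := by
  let ρ : G → ℕ := fun g => sInf {n | g ∈ D n}
  have hρ : ∀ g, g ∈ D (ρ g) := fun g => Nat.sInf_mem (hunion g)
  have hρle : ∀ g n, g ∈ D n → ρ g ≤ n := fun g n hg => Nat.sInf_le hg
  have hw_nonneg : ∀ n, 0 ≤ w n := fun n => hw0 ▸ hw (Nat.zero_le n)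
  refine ⟨{ toFun := fun g => w (ρ g), map_one' := ?_, mul_le' := ?_, inv' := ?_ }, ?_⟩
  · rw [Nat.le_zero.1 (hρle 1 0 (D 0).one_mem), hw0]
  · intro g h
    have : ρ (g * h) ≤ max (ρ g) (ρ h) := hρle _ _ <|
      (D _).mul_mem (hmono (le_max_left _ _) (hρ g)) (hmono (le_max_right _ _) (hρ h))
    refine (hw this).trans ?_
    rcases le_total (ρ g) (ρ h) with h' | h'
    · rw [max_eq_right h']; linarith [hw_nonneg (ρ g)]
    · rw [max_eq_left h']; linarith [hw_nonneg (ρ h)]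
  · intro g
    have key : ∀ g, ρ g⁻¹ ≤ ρ g := fun g => hρle _ _ ((D _).inv_mem (hρ g))
    rw [le_antisymm (key g) (by simpa using key g⁻¹)]
  · intro n g hg hgn
    change w (ρ g) = _
    congr 1
    refine le_antisymm (hρle _ _ hg) ?_
    by_contra hlt
    exact hgn (hmono (Nat.lt_succ_iff.1 (not_le.1 hlt)) (hρ g))

theorem exists_strictMono_of_not_fg {H : Subgroup G} (hH : ¬ H.FG) :
    ∃ D : ℕ → Subgroup G, StrictMono D := by
  have step : ∀ K : {K : Subgroup G // K.FG ∧ K ≤ H}, ∃ K' : {K : Subgroup G // K.FG ∧ K ≤ H},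
      K.1 < K'.1 := by
    rintro ⟨K, hK, hKH⟩
    have : ¬ H ≤ K := fun h => hH (le_antisymm hKH h ▸ hK)
    obtain ⟨x, hxH, hxK⟩ := SetLike.not_le_iff_exists.1 this
    refine ⟨⟨K ⊔ Subgroup.zpowers x, hK.sup ⟨{x}, by simp [Subgroup.zpowers_eq_closure]⟩,
      sup_le hKH (by simpa using hxH)⟩, lt_of_le_not_ge le_sup_left fun h => ?_⟩
    exact hxK (h (Subgroup.mem_sup_right (Subgroup.mem_zpowers x)))
  choose f hf using step
  refine ⟨fun n => (f^[n] ⟨⊥, ⟨∅, by simp⟩, bot_le⟩).1,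
    strictMono_nat_of_lt_succ fun n => ?_⟩
  rw [Function.iterate_succ_apply']
  exact hf _

/-- Any seminorm on `G` is at most linear in word length, so a seminorm on a subgroup that is
superlinear along a sequence cannot come from `G`. -/
theorem subgroup_fg_of_extensionProblemSolvable [Group.FG G]
    (hsol : ∀ H : Subgroup G, ExtensionProblemSolvable.{u, w} H) (H : Subgroup G) : H.FG := by
  by_contra hH
  obtain ⟨D, hD⟩ := exists_strictMono_of_not_fg hH
  have := countable_of_fg G
  choose x hxD hx using fun n : ℕ => SetLike.exists_of_lt (hD n.lt_succ_self)
  have hxsup : ∀ n, x n ∈ ⨆ n, D n := fun n => Subgroup.mem_iSup_of_mem (n + 1) (hxD n)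
  obtain ⟨len, hlen⟩ := exists_wordLength G
  -- The element `x n` first appears in `D (n + 1)`, so its seminorm is `wt (n + 1)`, at least `n`
  -- times its word length plus one.
  let wt : ℕ → ℝ := fun n => ∑ i ∈ Finset.range n, (i : ℝ) * (len (x i) + 1)
  have hwt : Monotone wt := monotone_nat_of_le_succ fun n => by
    simp only [wt, Finset.sum_range_succ]
    have : (0 : ℝ) ≤ n * (len (x n) + 1) := by positivity
    linarith
  have hwt' : ∀ n : ℕ, (n : ℝ) * (len (x n) + 1) ≤ wt (n + 1) := fun n => by
    have : 0 ≤ wt n := Finset.sum_nonneg fun i _ => by positivity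
    simp only [wt, Finset.sum_range_succ] at this ⊢
    linarith
  obtain ⟨ℓ, hℓ⟩ := exists_groupSeminorm_of_chain
    (D := fun n => (D n).subgroupOf (⨆ n, D n)) (fun n m h => Subgroup.comap_mono (hD.monotone h))
    (fun g => by
      obtain ⟨n, hn⟩ := (Subgroup.mem_iSup_of_directed hD.monotone.directed_le).1 g.2
      exact ⟨n, hn⟩) hwt (by simp [wt])
  obtain ⟨L, C, hC, hL⟩ := exists_groupSeminorm_of_extensionProblemSolvable (hsol (⨆ n, D n)) ℓ
  obtain ⟨C', hC'⟩ := hlen L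
  obtain ⟨n, hn⟩ := exists_nat_gt (C * |C'| + C)
  have h1 := (hL ⟨x n, hxsup n⟩).1
  rw [hℓ n ⟨x n, hxsup n⟩ (hxD n) (hx n)] at h1
  have h2 : L (x n) ≤ |C'| * len (x n) :=
    (hC' (x n)).trans (mul_le_mul_of_nonneg_right (le_abs_self _) (Nat.cast_nonneg _))
  have h3 : C * L (x n) ≤ C * (|C'| * len (x n)) := by gcongr
  have h4 : (0 : ℝ) ≤ len (x n) := Nat.cast_nonneg _
  have h5 := hwt' n
  have h6 : (C * |C'| + C) * (len (x n) + 1 : ℝ) < n * (len (x n) + 1) := by gcongr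
  have h7 : 0 ≤ C * |C'| := by positivity
  change wt (n + 1) ≤ C * L (x n) + C at h1
  nlinarith [mul_nonneg hC.le h4]

/-- A surjective endomorphism of a free `ℤ`-module which preserves the kernel of each functional
is `1` or `-1`. -/
theorem eq_or_eq_neg_of_forall_ker {M : Type u} [AddCommGroup M] [Module.Free ℤ M]
    (σ : M →ₗ[ℤ] M) (hσ : Function.Surjective σ)
    (h : ∀ (φ : M →ₗ[ℤ] ℤ) (a : M), φ a = 0 → φ (σ a) = 0) :
    (∀ a, σ a = a) ∨ ∀ a, σ a = -a := by
  let b := Module.Free.chooseBasis ℤ M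
  rcases isEmpty_or_nonempty (Module.Free.ChooseBasisIndex ℤ M) with hι | ⟨⟨i₀⟩⟩
  · have : Subsingleton M := b.repr.toEquiv.subsingleton
    exact Or.inl fun a => Subsingleton.elim _ _
  -- Coordinate functionals make the matrix of `σ` diagonal. Differences of two coordinates, tested
  -- on `b i + b i₀`, then make the diagonal constant, and surjectivity makes that scalar a unit of
  -- `ℤ`.
  have hoff : ∀ i j, i ≠ j → b.coord j (σ (b i)) = 0 := fun i j hij =>
    h (b.coord j) (b i) (by simp [hij])
  have hdiag : ∀ i, b.coord i (σ (b i)) = b.coord i₀ (σ (b i₀)) := fun i => by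
    by_cases hi : i = i₀
    · rw [hi]
    have := h (b.coord i - b.coord i₀) (b i + b i₀) (by simp [hi, Ne.symm hi])
    rw [map_add, LinearMap.sub_apply, map_add, map_add, hoff i i₀ hi, hoff i₀ i (Ne.symm hi)] at this
    linarith
  have hscalar : σ = b.coord i₀ (σ (b i₀)) • LinearMap.id := by
    refine b.ext fun i => b.repr.injective (Finsupp.ext fun j => ?_)
    by_cases hij : i = j
    · subst hij
      simpa using hdiag i
    · simpa [hij] using hoff i j hij
  obtain ⟨v, hv⟩ := hσ (b i₀)
  have hunit : IsUnit (b.coord i₀ (σ (b i₀))) := by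
    refine IsUnit.of_mul_eq_one (b.coord i₀ v) ?_
    have := congrArg (b.coord i₀) hv
    rw [hscalar] at this
    simpa using this
  rcases Int.isUnit_iff.1 hunit with h1 | h1
  · exact Or.inl fun a => by rw [hscalar, h1]; simp
  · exact Or.inr fun a => by rw [hscalar, h1]; simp

theorem free_additive_of_fg {A : Type u} [CommGroup A] [Group.FG A]
    (h : ∀ a : A, IsOfFinOrder a → a = 1) : Module.Free ℤ (Additive A) := by
  have : IsMulTorsionFree A := isMulTorsionFree_iff_not_isOfFinOrder.2 fun a ha h' => ha (h a h')
  exact Module.free_of_finite_type_torsion_free'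

/-- Conjugation preserves the kernel of each homomorphism from the subgroup `A` to `ℤ`, as far as
it stays in `A`. -/
theorem map_conj_eq_zero_of_extensionProblemSolvable [Countable G] {A : Subgroup G}
    (hsol : ExtensionProblemSolvable.{u, w} A) (φ : Additive A →+ ℤ) (t : G) (a a' : A)
    (ha' : (a' : G) = t * a * t⁻¹) (ha : φ (Additive.ofMul a) = 0) :
    φ (Additive.ofMul a') = 0 := by
  let ℓ : GroupSeminorm A :=
    { toFun := fun a => |(φ (Additive.ofMul a) : ℝ)|
      map_one' := by simp
      mul_le' := fun x y => by
        rw [ofMul_mul, map_add, Int.cast_add]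
        exact abs_add_le _ _
      inv' := fun x => by simp }
  have hℓ : ∀ (x : A) (n : ℕ), ℓ (x ^ n) = n * |(φ (Additive.ofMul x) : ℝ)| := fun x n => by
    change |(φ (Additive.ofMul (x ^ n)) : ℝ)| = _
    rw [ofMul_pow, map_nsmul]
    simp [abs_mul]
  obtain ⟨L, C, hC, hL⟩ := exists_groupSeminorm_of_extensionProblemSolvable hsol ℓ
  by_contra hne
  have h1 : (1 : ℝ) ≤ |(φ (Additive.ofMul a') : ℝ)| := by
    exact_mod_cast Int.one_le_abs hne
  -- Since `ℓ` vanishes on powers of `a`, `L (a ^ n) ≤ C` and so `L (a' ^ n) ≤ 2 * L t + C` for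
  -- every `n`, whereas `ℓ (a' ^ n) ≥ n`.
  obtain ⟨n, hn⟩ := exists_nat_gt (C * (2 * L t + C) + C)
  have h2 := (hL (a ^ n)).2
  rw [hℓ, ha] at h2
  have h3 := (hL (a' ^ n)).1
  rw [hℓ] at h3
  have h4 : ((a' ^ n : A) : G) = t * ((a ^ n : A) : G) * t⁻¹ := by
    rw [Subgroup.coe_pow, ha', conj_pow, Subgroup.coe_pow]
  have h5 := map_mul_le_add L (t * ((a ^ n : A) : G)) t⁻¹
  have h6 := map_mul_le_add L t ((a ^ n : A) : G)
  rw [map_inv_eq_map] at h5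
  rw [h4] at h3
  have h7 : C * L (t * ((a ^ n : A) : G) * t⁻¹) ≤ C * (2 * L t + C) := by
    gcongr
    simp at h2
    push_cast at *
    linarith
  have h8 : (n : ℝ) * 1 ≤ n * |(φ (Additive.ofMul a') : ℝ)| := by gcongr
  linarith

theorem conj_eq_or_eq_inv_of_extensionProblemSolvable [Countable G] {A : Subgroup G}
    (hsol : ExtensionProblemSolvable.{u, w} A) (hfg : A.FG)
    (hcomm : ∀ a ∈ A, ∀ b ∈ A, a * b = b * a) (htf : ∀ a ∈ A, IsOfFinOrder a → a = 1)
    {t : G} (ht : t ∈ Subgroup.normalizer (A : Set G)) :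
    (∀ a ∈ A, t * a * t⁻¹ = a) ∨ ∀ a ∈ A, t * a * t⁻¹ = a⁻¹ := by
  let _ : CommGroup A := { mul_comm := fun a b => Subtype.ext (hcomm a a.2 b b.2) }
  have : Group.FG A := (Group.fg_iff_subgroup_fg A).2 hfg
  have : Module.Free ℤ (Additive A) := free_additive_of_fg fun a ha =>
    Subtype.ext (htf a a.2 (Submonoid.isOfFinOrder_coe.2 ha))
  have hmem : ∀ s ∈ Subgroup.normalizer (A : Set G), ∀ a : A, s * a * s⁻¹ ∈ A := fun s hs a =>
    (Subgroup.mem_normalizer_iff.1 hs a).1 a.2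
  let c : A →* A :=
    { toFun := fun a => ⟨t * a * t⁻¹, hmem t ht a⟩
      map_one' := Subtype.ext (by simp)
      map_mul' := fun a b => Subtype.ext (by simp) }
  have hc : ∀ a : A, ((c a : A) : G) = t * a * t⁻¹ := fun _ => rfl
  have hsurj : Function.Surjective c := fun a =>
    ⟨⟨t⁻¹ * a * t⁻¹⁻¹, hmem _ (inv_mem ht) a⟩, Subtype.ext (by simp [hc, mul_assoc])⟩
  have key := eq_or_eq_neg_of_forall_ker (MonoidHom.toAdditive c).toIntLinearMap
    (fun a => hsurj a) (fun φ a ha =>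
      map_conj_eq_zero_of_extensionProblemSolvable hsol φ.toAddMonoidHom t a.toMul (c a.toMul)
        (hc _) ha)
  rcases key with h | h
  · exact Or.inl fun a ha => congrArg Subtype.val (h (Additive.ofMul ⟨a, ha⟩))
  · exact Or.inr fun a ha => congrArg Subtype.val (h (Additive.ofMul ⟨a, ha⟩))

end Solvable

/-! ### Virtually abelian subgroups -/

section VirtuallyAbelian

variable {G : Type u} [Group G]

/-- The subgroup `N` has an abelian subgroup of finite index. -/
def IsVirtuallyAbelian (N : Subgroup G) : Prop :=
  ∃ A ≤ N, A.relIndex N ≠ 0 ∧ ∀ a ∈ A, ∀ b ∈ A, a * b = b * a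

/-- In a group all of whose subgroups are finitely generated, a virtually abelian subgroup has a
torsion-free abelian subgroup of finite index which is normalized by its normalizer. -/
theorem IsVirtuallyAbelian.exists_torsionFree (hfg : ∀ H : Subgroup G, H.FG) {N : Subgroup G}
    (hN : IsVirtuallyAbelian N) :
    ∃ A ≤ N, A.relIndex N ≠ 0 ∧ (∀ a ∈ A, ∀ b ∈ A, a * b = b * a) ∧
      (∀ a ∈ A, IsOfFinOrder a → a = 1) ∧
      Subgroup.normalizer (N : Set G) ≤ Subgroup.normalizer (A : Set G) := by
  obtain ⟨A, hAN, hind, hcomm⟩ := hN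
  let T : Subgroup G :=
    { carrier := {a | a ∈ A ∧ IsOfFinOrder a}
      one_mem' := ⟨A.one_mem, IsOfFinOrder.one⟩
      mul_mem' := fun {a b} ha hb => ⟨A.mul_mem ha.1 hb.1,
        (show Commute a b from hcomm a ha.1 b hb.1).isOfFinOrder_mul ha.2 hb.2⟩
      inv_mem' := fun {a} ha => ⟨A.inv_mem ha.1, ha.2.inv⟩ }
  have hT : (⊥ : Subgroup G).relIndex T ≠ 0 := by
    refine relIndex_ne_zero_of_pow_mem (hfg T) (fun a ha b hb => hcomm a ha.1 b hb.1) fun a ha => ?_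
    obtain ⟨n, hn, h⟩ := isOfFinOrder_iff_pow_eq_one.1 ha.2
    exact ⟨n, hn, h⟩
  let k := (A.relIndex N).factorial
  let l := ((⊥ : Subgroup G).relIndex T).factorial
  have hk : ∀ x ∈ N, x ^ k ∈ A := fun x hx =>
    (Subgroup.pow_mem_of_relIndex_ne_zero_of_dvd hind hx
      fun m hm hm' => Nat.dvd_factorial hm hm').1
  have hl : ∀ a ∈ A, IsOfFinOrder a → a ^ l = 1 := fun a ha h =>
    (Subgroup.pow_mem_of_relIndex_ne_zero_of_dvd hT (show a ∈ T from ⟨ha, h⟩)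
      fun m hm hm' => Nat.dvd_factorial hm hm').1
  -- The generating set is invariant under the normalizer of `N`, which `A` itself need not be.
  -- Every element of `P` is an `l`-th power in `A`, and `l` kills the torsion of `A`, so `P` is
  -- torsion-free.
  let P : Subgroup G := Subgroup.closure {y | ∃ x ∈ N, y = x ^ (k * l)}
  have hP : ∀ y ∈ P, ∃ a ∈ A, y = a ^ l := by
    intro y hy
    refine Subgroup.closure_induction (p := fun y _ => ∃ a ∈ A, y = a ^ l) ?_ ?_ ?_ ?_ hy
    · rintro _ ⟨x, hx, rfl⟩
      exact ⟨x ^ k, hk x hx, pow_mul x k l⟩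
    · exact ⟨1, A.one_mem, by simp⟩
    · rintro _ _ _ _ ⟨a, ha, rfl⟩ ⟨b, hb, rfl⟩
      exact ⟨a * b, A.mul_mem ha hb, ((show Commute a b from hcomm a ha b hb).mul_pow l).symm⟩
    · rintro _ _ ⟨a, ha, rfl⟩
      exact ⟨a⁻¹, A.inv_mem ha, by simp⟩
  have hPA : P ≤ A := fun y hy => by
    obtain ⟨a, ha, rfl⟩ := hP y hy
    exact A.pow_mem ha l
  have hconj : ∀ g ∈ Subgroup.normalizer (N : Set G), ∀ y ∈ P, g * y * g⁻¹ ∈ P := by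
    intro g hg y hy
    have : P ≤ P.comap (MulAut.conj g).toMonoidHom := by
      refine (Subgroup.closure_le _).2 ?_
      rintro _ ⟨x, hx, rfl⟩
      refine Subgroup.subset_closure ⟨g * x * g⁻¹,
        (Subgroup.mem_normalizer_iff.1 hg x).1 hx, ?_⟩
      simp
    simpa using this hy
  refine ⟨P, hPA.trans hAN, ?_, fun a ha b hb => hcomm a (hPA ha) b (hPA hb), ?_, fun g hg => ?_⟩
  · refine Subgroup.relIndex_ne_zero_trans (relIndex_ne_zero_of_pow_mem (hfg A) hcomm fun a ha => ?_)
      hind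
    exact ⟨k * l, Nat.mul_pos (Nat.factorial_pos _) (Nat.factorial_pos _),
      Subgroup.subset_closure ⟨a, hAN ha, rfl⟩⟩
  · intro y hy hfin
    obtain ⟨a, ha, rfl⟩ := hP y hy
    exact hl a ha (hfin.of_pow (Nat.factorial_ne_zero _))
  · refine mem_normalizer_of_conj_mem (hconj g hg) fun y hy => ?_
    simpa using hconj g⁻¹ (inv_mem hg) y hy

/-- Conjugation by an element normalizing a torsion-free abelian subgroup is trivial or inverts
the subgroup. -/
def ConjTrivialOrInverts (G : Type u) [Group G] : Prop :=
  ∀ A : Subgroup G, (∀ a ∈ A, ∀ b ∈ A, a * b = b * a) → (∀ a ∈ A, IsOfFinOrder a → a = 1) →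
    ∀ t ∈ Subgroup.normalizer (A : Set G),
      (∀ a ∈ A, t * a * t⁻¹ = a) ∨ ∀ a ∈ A, t * a * t⁻¹ = a⁻¹

/-- With `A` torsion-free abelian of finite index in `N` and normalized by `t`, the action of `t` on
`A` squares to the identity. Hence `A` and `t ^ 2` generate an abelian subgroup. -/
theorem IsVirtuallyAbelian.sup_zpowers (hfg : ∀ H : Subgroup G, H.FG)
    (hconj : ConjTrivialOrInverts G) {N : Subgroup G} (hN : IsVirtuallyAbelian N) {t : G}
    (ht : t ∈ Subgroup.normalizer (N : Set G)) :
    IsVirtuallyAbelian (N ⊔ Subgroup.zpowers t) := by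
  obtain ⟨A, hAN, hind, hcomm, htf, hnorm⟩ := hN.exists_torsionFree hfg
  have htA := hnorm ht
  have hsq : ∀ a ∈ A, Commute (t ^ 2) a := by
    intro a ha
    have hta := (Subgroup.mem_normalizer_iff.1 htA a).1 ha
    have : t * (t * a * t⁻¹) * t⁻¹ = a := by
      rcases hconj A hcomm htf t htA with h | h
      · rw [h a ha, h a ha]
      · rw [h _ hta, h a ha, inv_inv]
    rw [Commute, SemiconjBy]
    nth_rewrite 2 [← this]
    simp [pow_two, mul_assoc]
  have hsqA : t ^ 2 ∈ Subgroup.normalizer (A : Set G) := pow_mem htA 2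
  refine ⟨A ⊔ Subgroup.zpowers (t ^ 2), sup_le (hAN.trans le_sup_left)
    ((Subgroup.zpowers_le.2 (Subgroup.mem_sup_right
      (Subgroup.pow_mem _ (Subgroup.mem_zpowers t) 2)))), ?_, ?_⟩
  · obtain ⟨s, hs, -, hcover⟩ := exists_finite_cover_of_relIndex_ne_zero hind
    -- The representatives `y` serve the even powers of `t`, and the `y * t` the odd ones.
    refine relIndex_ne_zero_of_finite_cover (hs.union (hs.image (· * t))) fun x hx => ?_
    obtain ⟨n, hn, j, rfl⟩ := exists_mul_zpow_of_mem_sup_zpowers ht hx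
    obtain ⟨y, hy, hyn⟩ := hcover n hn
    have hmem : ∀ i : ℤ, (t ^ 2) ^ i ∈ A ⊔ Subgroup.zpowers (t ^ 2) := fun i =>
      Subgroup.mem_sup_right ⟨i, rfl⟩
    rcases Int.even_or_odd' j with ⟨i, rfl | rfl⟩
    · refine ⟨y, Or.inl hy, ?_⟩
      have := Subgroup.mul_mem _ (Subgroup.mem_sup_left (T := Subgroup.zpowers (t ^ 2)) hyn) (hmem i)
      convert this using 1
      rw [zpow_mul, mul_assoc]
      norm_cast
    · refine ⟨y * t, Or.inr ⟨y, hy, rfl⟩, ?_⟩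
      have h1 := (Subgroup.mem_normalizer_iff.1 (inv_mem htA) _).1 hyn
      have := Subgroup.mul_mem _ (Subgroup.mem_sup_left (T := Subgroup.zpowers (t ^ 2)) h1) (hmem i)
      convert this using 1
      rw [add_comm, zpow_add, zpow_mul, zpow_one]
      norm_cast
      group
  · intro x hx y hy
    obtain ⟨a, ha, i, rfl⟩ := exists_mul_zpow_of_mem_sup_zpowers hsqA hx
    obtain ⟨b, hb, j, rfl⟩ := exists_mul_zpow_of_mem_sup_zpowers hsqA hy
    have hab : Commute a b := hcomm a ha b hb
    exact ((hab.mul_left ((hsq b hb).zpow_left i))).mul_right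
      (((hsq a ha).symm.zpow_right j).mul_left ((Commute.refl (t ^ 2)).zpow_zpow i j))

/-- Every subgroup between `N` and `M` is normal in `M`, so the finitely many generators of `M` can
be adjoined to `N` one at a time, each normalizing what precedes it. -/
theorem IsVirtuallyAbelian.of_commutator_mem (hfg : ∀ H : Subgroup G, H.FG)
    (hconj : ConjTrivialOrInverts G) {N M : Subgroup G} (hN : IsVirtuallyAbelian N) (hNM : N ≤ M)
    (hcomm : ∀ x ∈ M, ∀ y ∈ M, x * y * x⁻¹ * y⁻¹ ∈ N) : IsVirtuallyAbelian M := by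
  obtain ⟨s, hs⟩ := hfg M
  have key : ∀ s : Finset G, (s : Set G) ⊆ M → IsVirtuallyAbelian (N ⊔ Subgroup.closure (s : Set G)) := by
    classical
    intro s
    induction s using Finset.induction_on with
    | empty => intro _; simpa using hN
    | insert t s _ ih =>
      intro hsub
      rw [Finset.coe_insert, Set.insert_subset_iff] at hsub
      have hle : N ⊔ Subgroup.closure (s : Set G) ≤ M :=
        sup_le hNM ((Subgroup.closure_le _).2 hsub.2)
      have hconj' : ∀ g ∈ M, ∀ x ∈ N ⊔ Subgroup.closure (s : Set G),
          g * x * g⁻¹ ∈ N ⊔ Subgroup.closure (s : Set G) := fun g hg x hx => by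
        have := Subgroup.mul_mem _ (Subgroup.mem_sup_left (T := Subgroup.closure (s : Set G))
          (hcomm g hg x (hle hx))) hx
        simpa using this
      have := (ih hsub.2).sup_zpowers hfg hconj (t := t) (mem_normalizer_of_conj_mem
        (hconj' t hsub.1) fun x hx => by simpa using hconj' t⁻¹ (M.inv_mem hsub.1) x hx)
      rwa [Subgroup.zpowers_eq_closure, sup_assoc, ← Subgroup.closure_union, Set.union_comm,
        Set.singleton_union, ← Finset.coe_insert] at this
  have := key s (hs ▸ Subgroup.subset_closure)
  rwa [hs, sup_eq_right.2 hNM] at this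

/-- Let all subgroups of `G` be finitely generated, and let `G` satisfy `ConjTrivialOrInverts`.
If `T` relates the elementary amenable group `E` to `G`, then the image of `T` in `G` is virtually
abelian as soon as its fiber over `1` is. -/
theorem IsElementaryAmenable.isVirtuallyAbelian_map_snd (hfg : ∀ H : Subgroup G, H.FG)
    (hconj : ConjTrivialOrInverts G) {E : Type v} [Group E] (hE : IsElementaryAmenable E) :
    ∀ T : Subgroup (E × G), IsVirtuallyAbelian (T.comap (MonoidHom.inr E G)) →
      IsVirtuallyAbelian (T.map (MonoidHom.snd E G)) := by
  have hle : ∀ {E : Type v} [Group E] (T : Subgroup (E × G)),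
      T.comap (MonoidHom.inr E G) ≤ T.map (MonoidHom.snd E G) := fun T x hx =>
    ⟨(1, x), hx, rfl⟩
  induction hE with
  | of_comm E hcomm =>
    intro T hT
    refine hT.of_commutator_mem hfg hconj (hle T) ?_
    rintro _ ⟨⟨e, x⟩, hx, rfl⟩ _ ⟨⟨e', y⟩, hy, rfl⟩
    have := T.mul_mem (T.mul_mem (T.mul_mem hx hy) (T.inv_mem hx)) (T.inv_mem hy)
    have he : e * e' * e⁻¹ * e'⁻¹ = 1 := by rw [hcomm e e']; group
    simpa [he] using this
  | of_finite E hfin =>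
    rintro T ⟨A, hA, hind, hcomm⟩
    refine ⟨A, hA.trans (hle T), Subgroup.relIndex_ne_zero_trans hind ?_, hcomm⟩
    classical
    -- The fiber of `T` over each `e` is empty or a coset of the fiber over `1`; `y e` represents
    -- it, with the irrelevant value `1` when it is empty.
    let y : E → G := fun e => if h : ∃ x, (e, x) ∈ T then h.choose else 1
    refine relIndex_ne_zero_of_finite_cover (Set.finite_range y) ?_
    rintro _ ⟨⟨e, x⟩, hx, rfl⟩
    refine ⟨y e, ⟨e, rfl⟩, ?_⟩
    have h : ∃ x, (e, x) ∈ T := ⟨x, hx⟩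
    have hy : (e, y e) ∈ T := by
      simp only [y, dif_pos h]
      exact h.choose_spec
    have := T.mul_mem (T.inv_mem hy) hx
    simpa using this
  | of_injective E F f hf _ ih =>
    intro T hT
    have h1 : (T.map (f.prodMap (MonoidHom.id G))).comap (MonoidHom.inr E G) =
        T.comap (MonoidHom.inr F G) := by
      ext x
      simp [Subgroup.mem_map, map_eq_one_iff f hf]
    have h2 : (T.map (f.prodMap (MonoidHom.id G))).map (MonoidHom.snd E G) =
        T.map (MonoidHom.snd F G) := by
      rw [Subgroup.map_map]
      rfl
    rw [← h2]
    exact ih _ (h1 ▸ hT)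
  | of_surjective E Q f hf _ ih =>
    intro T hT
    have h1 : (T.comap (f.prodMap (MonoidHom.id G))).comap (MonoidHom.inr E G) =
        T.comap (MonoidHom.inr Q G) := by
      ext x
      simp
    have h2 : (T.comap (f.prodMap (MonoidHom.id G))).map (MonoidHom.snd E G) =
        T.map (MonoidHom.snd Q G) := by
      ext x
      simp [Subgroup.mem_map, hf.exists]
    rw [← h2]
    exact ih _ (h1 ▸ hT)
  | of_extension E N _ _ ihN ihQ =>
    intro T hT
    have h1 : (T.comap (N.subtype.prodMap (MonoidHom.id G))).comap (MonoidHom.inr N G) =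
        T.comap (MonoidHom.inr E G) := by
      ext x
      simp
    -- The two inductive steps fit together here: the fiber over `1 ∈ E ⧸ N` is the image of the
    -- part of `T` lying over `N`.
    have h2 : (T.map ((QuotientGroup.mk' N).prodMap (MonoidHom.id G))).comap
        (MonoidHom.inr (E ⧸ N) G) =
        (T.comap (N.subtype.prodMap (MonoidHom.id G))).map (MonoidHom.snd N G) := by
      ext x
      simp [Subgroup.mem_map, and_comm]
    have h3 : (T.map ((QuotientGroup.mk' N).prodMap (MonoidHom.id G))).map
        (MonoidHom.snd (E ⧸ N) G) = T.map (MonoidHom.snd E G) := by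
      rw [Subgroup.map_map]
      rfl
    rw [← h3]
    exact ihQ _ (h2 ▸ ihN _ (h1 ▸ hT))
  | of_directed_union E F hdir hunion _ ih =>
    intro T hT
    -- The image is finitely generated, and lifts of its generators have their `E`-components in a
    -- single member `K` of the directed family. So the part of `T` over `K` already has the full
    -- image.
    obtain ⟨s, hs⟩ := hfg (T.map (MonoidHom.snd E G))
    have key : ∀ s : Finset G, (∀ x ∈ s, ∃ e, (e, x) ∈ T) →
        ∃ K ∈ F, ∀ x ∈ s, ∃ e ∈ K, (e, x) ∈ T := by
      classical
      intro s
      induction s using Finset.induction_on with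
      | empty =>
        obtain ⟨K, hK, -⟩ := hunion 1
        exact fun _ => ⟨K, hK, by simp⟩
      | insert t s _ ihs =>
        intro h
        obtain ⟨K, hK, hKs⟩ := ihs fun x hx => h x (Finset.mem_insert_of_mem hx)
        obtain ⟨e, he⟩ := h t (Finset.mem_insert_self t s)
        obtain ⟨K', hK', heK'⟩ := hunion e
        obtain ⟨K'', hK'', hle1, hle2⟩ := hdir K hK K' hK'
        refine ⟨K'', hK'', fun x hx => ?_⟩
        rcases Finset.mem_insert.1 hx with rfl | hx
        · exact ⟨e, hle2 heK', he⟩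
        · obtain ⟨e, he, hex⟩ := hKs x hx
          exact ⟨e, hle1 he, hex⟩
    obtain ⟨K, hK, hKs⟩ := key s fun x hx => by
      have : x ∈ T.map (MonoidHom.snd E G) := hs ▸ Subgroup.subset_closure hx
      obtain ⟨⟨e, y⟩, hy, rfl⟩ := this
      exact ⟨e, hy⟩
    have h1 : (T.comap (K.subtype.prodMap (MonoidHom.id G))).comap (MonoidHom.inr K G) =
        T.comap (MonoidHom.inr E G) := by
      ext x
      simp
    have h2 : (T.comap (K.subtype.prodMap (MonoidHom.id G))).map (MonoidHom.snd K G) =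
        T.map (MonoidHom.snd E G) := by
      refine le_antisymm ?_ ?_
      · rintro _ ⟨⟨k, x⟩, hx, rfl⟩
        exact ⟨(k, x), hx, rfl⟩
      · rw [← hs, Subgroup.closure_le]
        intro x hx
        obtain ⟨e, he, hex⟩ := hKs x hx
        exact ⟨(⟨e, he⟩, x), hex, rfl⟩
    rw [← h2]
    exact ih K hK _ (h1 ▸ hT)

theorem IsElementaryAmenable.isVirtuallyAbelian_top (hG : IsElementaryAmenable G)
    (hfg : ∀ H : Subgroup G, H.FG) (hconj : ConjTrivialOrInverts G) :
    IsVirtuallyAbelian (⊤ : Subgroup G) := by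
  have := hG.isVirtuallyAbelian_map_snd hfg hconj
    ((MonoidHom.id G).prod (MonoidHom.id G)).range ⟨⊥, bot_le, ?_, ?_⟩
  · convert this
    refine (eq_top_iff.2 fun x _ => ⟨(x, x), ⟨x, rfl⟩, rfl⟩).symm
  · rw [show ((MonoidHom.id G).prod (MonoidHom.id G)).range.comap (MonoidHom.inr G G) = ⊥ from ?_]
    · simp
    · refine (Subgroup.eq_bot_iff_forall _).2 ?_
      rintro x ⟨y, hy⟩
      have h1 : y = 1 := congrArg Prod.fst hy
      have h2 : y = x := congrArg Prod.snd hy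
      rw [← h2, h1]
  · simp

end VirtuallyAbelian

/-! ### The characterization -/

theorem isFreeAbelian_of_fg {A : Type u} [Group A] [Group.FG A]
    (hcomm : ∀ a b : A, a * b = b * a) (htf : ∀ a : A, IsOfFinOrder a → a = 1) :
    IsFreeAbelian A := by
  let _ : CommGroup A := { mul_comm := hcomm }
  have := free_additive_of_fg htf
  let b := Module.Free.chooseBasis ℤ (Additive A)
  exact ⟨_, ⟨AddEquiv.toMultiplicativeRight
    (b.repr.toAddEquiv.trans (FreeAbelianGroup.equivFinsupp _).symm)⟩⟩

/-- If each element of `G` centralizes or inverts the torsion-free subgroup `A`, then the sign is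
a homomorphism. -/
theorem conjFactorsThroughInversion_of_forall {G : Type u} [Group G] {A : Subgroup G}
    (htf : ∀ a ∈ A, IsOfFinOrder a → a = 1)
    (hconj : ∀ g : G, (∀ a ∈ A, g * a * g⁻¹ = a) ∨ ∀ a ∈ A, g * a * g⁻¹ = a⁻¹) :
    ConjFactorsThroughInversion A := by
  classical
  by_cases hA : ∃ a ∈ A, a ≠ 1
  · obtain ⟨a₀, ha₀, hne⟩ := hA
    -- Without 2-torsion, a single `a₀ ≠ 1` decides whether an element centralizes or inverts all of
    -- `A`.
    have hinv : a₀⁻¹ ≠ a₀ := fun h => hne <| htf a₀ ha₀ <|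
      isOfFinOrder_iff_pow_eq_one.2 ⟨2, two_pos, by
        rw [pow_two]
        nth_rewrite 1 [← h]
        exact inv_mul_cancel a₀⟩
    have hfix : ∀ g, g * a₀ * g⁻¹ = a₀ → ∀ a ∈ A, g * a * g⁻¹ = a := fun g hg =>
      (hconj g).resolve_right fun h => hinv ((h a₀ ha₀).symm.trans hg)
    have hflip : ∀ g, g * a₀ * g⁻¹ ≠ a₀ → ∀ a ∈ A, g * a * g⁻¹ = a⁻¹ := fun g hg =>
      (hconj g).resolve_left fun h => hg (h a₀ ha₀)
    let s : G → Multiplicative (ZMod 2) := fun g =>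
      if g * a₀ * g⁻¹ = a₀ then 1 else Multiplicative.ofAdd 1
    have hs : ∀ g, s g = 1 ↔ g * a₀ * g⁻¹ = a₀ := fun g => by
      simp only [s]
      split_ifs with h
      · simp [h]
      · simp only [h, iff_false]
        decide
    refine ⟨{ toFun := s, map_one' := by simp [s], map_mul' := fun g h => ?_ }, fun g a ha =>
      ⟨fun hg => hfix g ((hs g).1 hg) a ha, fun hg => hflip g (fun h => hg ((hs g).2 h)) a ha⟩⟩
    have hmul : g * h * a₀ * (g * h)⁻¹ = g * (h * a₀ * h⁻¹) * g⁻¹ := by group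
    have htwo : (Multiplicative.ofAdd 1 : Multiplicative (ZMod 2)) * Multiplicative.ofAdd 1 = 1 := by
      decide
    simp only [s, hmul]
    by_cases h1 : h * a₀ * h⁻¹ = a₀
    · simp [h1]
    · have h2 := hflip h h1 a₀ ha₀
      by_cases h3 : g * a₀ * g⁻¹ = a₀
      · have h4 := hfix g h3 _ (A.inv_mem ha₀)
        simp [h2, h3, h4, hinv]
      · have h4 := hflip g h3 _ (A.inv_mem ha₀)
        rw [h2, h4, if_pos (inv_inv a₀), if_neg h3, if_neg hinv, htwo]
  · push Not at hA
    exact ⟨1, fun g a ha => ⟨fun _ => by simp [hA a ha], fun h => absurd rfl h⟩⟩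

theorem exists_finiteIndex_conjFactorsThroughInversion {G : Type u} [Group G] [Group.FG G]
    (hG : IsElementaryAmenable G) (hsol : ∀ H : Subgroup G, ExtensionProblemSolvable.{u, w} H) :
    ∃ A : Subgroup G, A.FiniteIndex ∧ IsFreeAbelian A ∧ ConjFactorsThroughInversion A := by
  have := countable_of_fg G
  have hfg : ∀ H : Subgroup G, H.FG := subgroup_fg_of_extensionProblemSolvable hsol
  have hconj : ConjTrivialOrInverts G := fun A hcomm htf t ht =>
    conj_eq_or_eq_inv_of_extensionProblemSolvable (hsol A) (hfg A) hcomm htf ht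
  obtain ⟨A, -, hind, hcomm, htf, hnorm⟩ :=
    (hG.isVirtuallyAbelian_top hfg hconj).exists_torsionFree hfg
  have : Group.FG A := (Group.fg_iff_subgroup_fg A).2 (hfg A)
  refine ⟨A, ⟨by rwa [Subgroup.relIndex_top_right] at hind⟩,
    isFreeAbelian_of_fg (fun a b => Subtype.ext (hcomm a a.2 b b.2))
      fun a ha => Subtype.ext (htf a a.2 (Submonoid.isOfFinOrder_coe.2 ha)),
    conjFactorsThroughInversion_of_forall htf fun g => hconj A hcomm htf g (hnorm ?_)⟩
  exact Subgroup.mem_normalizer_iff.2 fun x => by simp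

end ExtProblem

theorem mainTheorem4 (G : Type u) [Group G] [Group.FG G]
    (hG : ExtProblem.IsElementaryAmenable G) :
    (∀ H : Subgroup G, ExtProblem.ExtensionProblemSolvable.{u, w} H) ↔
      ∃ A : Subgroup G, A.FiniteIndex ∧ ExtProblem.IsFreeAbelian A ∧
        ExtProblem.ConjFactorsThroughInversion A := by
  refine ⟨ExtProblem.exists_finiteIndex_conjFactorsThroughInversion hG, ?_⟩
  rintro ⟨A, _, hfree, hconj⟩ H
  exact ExtProblem.extensionProblemSolvable_of_conjFactorsThroughInversion hfree hconj H
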